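/- Let $B$ be the one-sided stationary generalized Bratteli diagram with vertex set $V_n=\mathbb N=\{1,2,\dots\}$ on each level $n\ge 0$ and incidence matrix $F=(f_{v,w})_{v,w\in\mathbb N}$, $f_{v,w}=1$ if $v\in\{w,w+1\}$ and $f_{v,w}=0$ otherwise; that is, each vertex $w$ of level $n$ is joined by one edge to the vertex $w$ and by one edge to the vertex $w+1$ of level $n+1$. Let $X_B$ be the Polish space of infinite paths $x=(x_0,x_1,\dots)$ starting at level $0$, with the topology generated by the cylinder sets $[\overline e]$ of finite paths $\overline e=(e_0,\dots,e_n)$. Two paths $x,y$ are tail equivalent if $x_k=y_k$ for all large $k$. A Borel measure on $X_B$ is tail invariant if $\mu([\overline e])=\mu([\overline e'])$ whenever $\overline e,\overline e'$ end at the same vertex of the same level, and ergodic if every Borel set that is a union of tail equivalence classes is null or has null complement. All measures are assumed non-atomic. For $i\in\mathbb N$ let $B_i$ be the vertex subdiagram of $B$ with vertices $\{i,\dots,i+n\}$ on level $n$ (a classical Pascal diagram), and let $X_{B_i}\subset X_B$ be its path space, i.e. the set of paths starting at the vertex $i$ of level $0$. For $0<p<1$ let $\nu_p^{(i)}$ be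 the probability measure on $X_{B_i}$ for which the measure of a cylinder set is the product of the weights of its edges, where each edge $w\to w$ has weight $p$ and each edge $w\to w+1$ has weight $1-p$. Let $\widehat\nu_p^{(i)}$ be its extension to $X_B$ by tail invariance: the measure on $X_B$ such that, whenever a finite path $\overline e'$ of $B$ ends at the same vertex of the same level as a finite path $\overline e$ of $B_i$, the set of all infinite continuations of $\overline e'$ that stay in $B_i$ from that vertex on has measure $\nu_p^{(i)}([\overline e])$, and such that the set of paths not tail equivalent to any path of $B_i$ is null. Then for every $i\in\mathbb N$: for each $p\in(\tfrac12,1)$ the extension $\widehat\nu_p^{(i)}$ exists, is unique, and satisfies $0<\widehat\nu_p^{(i)}(X_B)<\infty$; and $$\left\{\frac{\widehat\nu_p^{(i)}}{\widehat\nu_p^{(i)}(X_B)} : p\in(\tfrac12,1)\right\}$$ is exactly the set of all (non-atomic) ergodic tail invariant probability measures on $X_B$. -/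

import Mathlib

open MeasureTheory ProbabilityTheory

/-- A generalized Bratteli diagram: countably infinite levels `V n`, countable edge sets `E n`
between `V n` and `V (n + 1)`, surjective source and range maps, finitely many edges into each
vertex. -/
structure GenBratteliDiagram where
  V : ℕ → Type
  E : ℕ → Type
  source : ∀ n, E n → V n
  range : ∀ n, E n → V (n + 1)
  countable_V : ∀ n, Countable (V n)
  infinite_V : ∀ n, Infinite (V n)
  countable_E : ∀ n, Countable (E n)
  source_surjective : ∀ n, Function.Surjective (source n)
  range_surjective : ∀ n, Function.Surjective (range n)
  finite_fiber : ∀ n (v : V (n + 1)), {e : E n | range n e = v}.Finite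

namespace GenBratteliDiagram

/-- Entry `f_{v,w}` of the `n`-th incidence matrix: the number of edges between `v ∈ V (n + 1)`
and `w ∈ V n`. -/
noncomputable def incidence (B : GenBratteliDiagram) (n : ℕ) : Matrix (B.V (n + 1)) (B.V n) ℕ :=
  fun v w => Nat.card {e : B.E n // B.range n e = v ∧ B.source n e = w}

/-- The space `X_B` of infinite paths that start at level `0`. -/
def Path (B : GenBratteliDiagram) : Type :=
  {x : ∀ n, B.E n // ∀ n, B.source (n + 1) (x (n + 1)) = B.range n (x n)}

variable {B : GenBratteliDiagram}

/-- The cylinder set `[(x_0, …, x_n)]`. Since all source maps are surjective, every finite path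
starting at level `0` is an initial segment of an infinite path `x`, so these are all the cylinder
sets. -/
def cylinderSet (x : B.Path) (n : ℕ) : Set B.Path := {y | ∀ k ≤ n, y.1 k = x.1 k}

/-- The vertex of level `n + 1` in which the finite path `(x_0, …, x_n)` ends. -/
def endVertex (x : B.Path) (n : ℕ) : B.V (n + 1) := B.range n (x.1 n)

/-- The topology generated by the cylinder sets. -/
instance : TopologicalSpace B.Path :=
  TopologicalSpace.generateFrom {S | ∃ (x : B.Path) (n : ℕ), S = cylinderSet x n}

instance : MeasurableSpace B.Path := borel B.Path

instance : BorelSpace B.Path := ⟨rfl⟩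

/-- Tail equivalence of infinite paths. -/
def TailEquiv (x y : B.Path) : Prop := ∃ n, ∀ k ≥ n, x.1 k = y.1 k

/-- Tail invariance: cylinder sets of finite paths with the same end have the same measure. -/
def TailInvariant (μ : Measure B.Path) : Prop :=
  ∀ (n : ℕ) (x y : B.Path), endVertex x n = endVertex y n →
    μ (cylinderSet x n) = μ (cylinderSet y n)

/-- Ergodicity with respect to tail equivalence: every Borel set that is a union of tail
equivalence classes is null or has null complement. -/
def TailErgodic (μ : Measure B.Path) : Prop :=
  ∀ A : Set B.Path, MeasurableSet A → (∀ x y, TailEquiv x y → x ∈ A → y ∈ A) →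
    μ A = 0 ∨ μ Aᶜ = 0

/-- The (non-atomic) ergodic tail invariant probability measures on `X_B`. -/
structure IsErgodicTailInvariantProb (μ : Measure B.Path) : Prop where
  isProbabilityMeasure : IsProbabilityMeasure μ
  noAtoms : ∀ x, μ {x} = 0
  tailInvariant : TailInvariant μ
  tailErgodic : TailErgodic μ

/-- A vertex subdiagram: nonempty proper sets of vertices `W n ⊆ V n`, together with all edges of
`B` between them, such that every vertex of the subdiagram is the source of such an edge and every
vertex of positive level is the range of such an edge. -/
structure VertexSubdiagram (B : GenBratteliDiagram) where
  W : ∀ n, Set (B.V n)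
  nonempty : ∀ n, (W n).Nonempty
  proper : ∀ n, W n ≠ Set.univ
  source_surjective : ∀ n, ∀ w ∈ W n, ∃ e, B.source n e = w ∧ B.range n e ∈ W (n + 1)
  range_surjective : ∀ n, ∀ v ∈ W (n + 1), ∃ e, B.range n e = v ∧ B.source n e ∈ W n

/-- The path space of a vertex subdiagram, as a subset of `X_B`: the paths that visit only vertices
of the subdiagram. -/
def VertexSubdiagram.paths (S : VertexSubdiagram B) : Set B.Path :=
  {x | ∀ n, B.source n (x.1 n) ∈ S.W n}

/-- All paths of `B` that are tail equivalent to some path of the subdiagram. -/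
def VertexSubdiagram.saturation (S : VertexSubdiagram B) : Set B.Path :=
  {x | ∃ y ∈ S.paths, TailEquiv x y}

/-- `μ'` is the extension by tail invariance to `X_B` of the measure `μ` on the path space of the
subdiagram `S`: whenever a finite path `(x_0, …, x_n)` of `B` ends in the same vertex as a finite
path `(y_0, …, y_n)` of `S`, the set of all continuations of `(x_0, …, x_n)` that stay in `S` after
level `n` has the same measure as the cylinder set of `(y_0, …, y_n)` in the path space of `S`;
and the complement of the saturation of the path space of `S` is null. -/
def VertexSubdiagram.IsExtension (S : VertexSubdiagram B) (μ : Measure S.paths)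
    (μ' : Measure B.Path) : Prop :=
  (∀ (n : ℕ) (x : B.Path) (y : S.paths), endVertex x n = endVertex y.1 n →
    μ' {z | z ∈ cylinderSet x n ∧ ∀ k > n, B.source k (z.1 k) ∈ S.W k} =
      μ {z | z.1 ∈ cylinderSet y.1 n}) ∧
  μ' S.saturationᶜ = 0

end GenBratteliDiagram

open GenBratteliDiagram

/-- The `ℕ × ℕ` matrix with ones on the diagonal and on the subdiagonal, and zeros elsewhere. -/
def pascalMatrix : Matrix ℕ ℕ ℕ := fun v w => if v = w ∨ v = w + 1 then 1 else 0

/-- The one-sided stationary generalized Bratteli diagram with incidence matrix `pascalMatrix`.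
The edge `(w, false)` joins `w` to `w`, the edge `(w, true)` joins `w` to `w + 1`. The vertices of
each level are numbered from `0`. -/
abbrev pascalGBD : GenBratteliDiagram where
  V _ := ℕ
  E _ := ℕ × Bool
  source _ e := e.1
  range _ e := e.1 + e.2.toNat
  countable_V _ := inferInstance
  infinite_V _ := inferInstance
  countable_E _ := inferInstance
  source_surjective _ w := ⟨(w, false), rfl⟩
  range_surjective _ v := ⟨(v, false), rfl⟩
  finite_fiber _ v := by
    refine ((Set.finite_Iic v).prod (Set.finite_univ (α := Bool))).subset ?_
    rintro ⟨w, b⟩ h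
    simp only [Set.mem_ofPred_eq] at h
    simp only [Set.mem_prod, Set.mem_Iic, Set.mem_univ, and_true]
    omega

theorem pascalGBD_incidence (n : ℕ) : pascalGBD.incidence n = pascalMatrix := by
  ext v w
  change Nat.card {e : ℕ × Bool // e.1 + e.2.toNat = v ∧ e.1 = w} = if v = w ∨ v = w + 1 then 1 else 0
  split_ifs with h
  · rw [Nat.card_eq_one_iff_unique]
    refine ⟨⟨?_⟩, ?_⟩
    · rintro ⟨⟨a, b⟩, h1, h2⟩ ⟨⟨c, d⟩, h3, h4⟩
      simp only at h1 h2 h3 h4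
      have hbd : b = d := by
        have : b.toNat = d.toNat := by omega
        revert this; cases b <;> cases d <;> simp
      simp only [Subtype.mk.injEq, Prod.mk.injEq]
      exact ⟨by omega, hbd⟩
    · rcases h with h | h
      · exact ⟨⟨(w, false), by simp [h], rfl⟩⟩
      · exact ⟨⟨(w, true), by simp [h], rfl⟩⟩
  · have : IsEmpty {e : ℕ × Bool // e.1 + e.2.toNat = v ∧ e.1 = w} := by
      refine ⟨?_⟩
      rintro ⟨⟨a, b⟩, h1, h2⟩
      cases b <;> simp_all
    simp

/-- The vertex subdiagram `B_i` with vertices `{i, …, i + n}` on level `n` (a Pascal diagram). -/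
abbrev pascalSub (i : ℕ) : VertexSubdiagram pascalGBD where
  W n := Set.Icc i (i + n)
  nonempty n := ⟨i, by simp⟩
  proper n h := by
    have : i + n + 1 ∈ Set.Icc i (i + n) := h ▸ Set.mem_univ _
    simp only [Set.mem_Icc] at this
    omega
  source_surjective n (w : ℕ) hw := by
    have h : i ≤ w ∧ w ≤ i + n := hw
    exact ⟨(w, false), rfl, show i ≤ w + 0 ∧ w + 0 ≤ i + (n + 1) by omega⟩
  range_surjective n (v : ℕ) hv := by
    have h : i ≤ v ∧ v ≤ i + (n + 1) := hv
    by_cases hi : v = i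
    · exact ⟨(v, false), rfl, show i ≤ v ∧ v ≤ i + n by omega⟩
    · exact ⟨(v - 1, true), show v - 1 + 1 = v by omega,
        show i ≤ v - 1 ∧ v - 1 ≤ i + n by omega⟩

/-- The path of `B_i` that starts at the vertex `i` and whose `n`-th edge goes from its source to
the vertex with the same number if `b n = false`, and with the next number if `b n = true`. -/
def pascalPath (i : ℕ) (b : ℕ → Bool) : (pascalSub i).paths :=
  ⟨⟨fun n => (i + ∑ k ∈ Finset.range n, (b k).toNat, b n), fun n => by
      simp [Finset.sum_range_succ, add_assoc]⟩, fun n => by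
      have : ∑ k ∈ Finset.range n, (b k).toNat ≤ ∑ k ∈ Finset.range n, 1 :=
        Finset.sum_le_sum fun k _ => Bool.toNat_le _
      simp only [Finset.sum_const, Finset.card_range, smul_eq_mul, mul_one] at this
      simp only [Set.mem_Icc]
      omega⟩

/-- The measure `ν_p` on the path space of the Pascal diagram `B_i`: independently at each level,
an edge of the form `w → w` is chosen with probability `p` and an edge of the form `w → w + 1` with
probability `1 - p`. -/
noncomputable def pascalMeasure (i : ℕ) (p : unitInterval) : Measure (pascalSub i).paths :=
  (Measure.infinitePi fun _ : ℕ => bernoulliMeasure false true p).map (pascalPath i)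

theorem measurable_pascalPath (i : ℕ) : Measurable (pascalPath i) := by
  refine Measurable.subtype_mk (Continuous.measurable ?_)
  refine continuous_generateFrom_iff.2 ?_
  rintro _ ⟨x, n, rfl⟩
  have : (fun b => (pascalPath i b).1) ⁻¹' cylinderSet x n =
      ⋂ k ∈ Finset.range (n + 1), {b : ℕ → Bool | (pascalPath i b).1.1 k = x.1 k} := by
    ext b
    simp [cylinderSet]
  change IsOpen ((fun b => (pascalPath i b).1) ⁻¹' cylinderSet x n)
  rw [this]
  refine isOpen_biInter_finset fun k _ => ?_
  have hc : Continuous fun b : ℕ → Bool =>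
      ((i + ∑ j ∈ Finset.range k, (b j).toNat, b k) : ℕ × Bool) := by
    refine Continuous.prodMk (continuous_const.add (continuous_finsetSum _ fun j _ => ?_))
      (continuous_apply k)
    exact (continuous_of_discreteTopology (f := Bool.toNat)).comp (continuous_apply j)
  exact (isOpen_discrete ({(x.1 k : ℕ × Bool)} : Set (ℕ × Bool))).preimage hc

/-- The measure of a cylinder set is the product of the weights of its edges. -/
theorem pascalMeasure_cylinder (i : ℕ) (p : unitInterval) (x : (pascalSub i).paths) (n : ℕ) :
    pascalMeasure i p {z | z.1 ∈ cylinderSet x.1 n} =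
      ∏ k ∈ Finset.range (n + 1),
        if (x.1.1 k).2 then ENNReal.ofReal (1 - p) else ENNReal.ofReal p := by
  have hm : MeasurableSet {z : (pascalSub i).paths | z.1 ∈ cylinderSet x.1 n} := by
    have : IsOpen (cylinderSet x.1 n) := TopologicalSpace.isOpen_generateFrom_of_mem ⟨x.1, n, rfl⟩
    exact measurable_subtype_coe this.measurableSet
  have hsrc : ∀ k, (x.1.1 k).1 = i + ∑ j ∈ Finset.range k, (x.1.1 j).2.toNat := by
    intro k
    induction k with
    | zero =>
      have h : i ≤ (x.1.1 0).1 ∧ (x.1.1 0).1 ≤ i + 0 := x.2 0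
      simp only [Finset.range_zero, Finset.sum_empty]
      omega
    | succ k ih =>
      have h : (x.1.1 (k + 1)).1 = (x.1.1 k).1 + (x.1.1 k).2.toNat := x.1.2 k
      rw [h, ih, Finset.sum_range_succ, add_assoc]
  have hpre : pascalPath i ⁻¹' {z | z.1 ∈ cylinderSet x.1 n} =
      Set.pi (Finset.range (n + 1)) fun k => {(x.1.1 k).2} := by
    ext b
    simp only [Set.mem_preimage, Set.mem_ofPred_eq, cylinderSet, Set.mem_pi, Set.mem_singleton_iff,
      Finset.mem_coe, Finset.mem_range, Nat.lt_succ_iff]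
    refine ⟨fun h k hk => congrArg Prod.snd (h k hk), fun h k hk => Prod.ext ?_ (h k hk)⟩
    rw [hsrc k]
    change i + _ = i + _
    congr 1
    exact Finset.sum_congr rfl fun j hj => by
      rw [h j ((Finset.mem_range.1 hj).le.trans hk)]
  rw [pascalMeasure, Measure.map_apply (measurable_pascalPath i) hm, hpre,
    Measure.infinitePi_pi (fun _ => bernoulliMeasure false true p)
      (fun _ _ => MeasurableSet.singleton _)]
  refine Finset.prod_congr rfl fun k _ => ?_
  have hp : ENNReal.ofReal (p : ℝ) = (unitInterval.toNNReal p : ENNReal) := by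
    rw [ENNReal.ofReal, Real.toNNReal_of_nonneg p.2.1]
    rfl
  have hq : ENNReal.ofReal (1 - (p : ℝ)) =
      (unitInterval.toNNReal (unitInterval.symm p) : ENNReal) := by
    rw [ENNReal.ofReal, Real.toNNReal_of_nonneg (sub_nonneg.2 p.2.2)]
    rfl
  rw [bernoulliMeasure_apply p (MeasurableSet.singleton _), hp, hq]
  cases (x.1.1 k).2 <;> simp

/-! Put r = (1 - p) / p. Under a tail invariant measure the mass of a cylinder set depends only on
its length and its end vertex, and splitting by the next edge gives the Pascal recursion
`weight_eq_add`. For 0 < p < 1 one solution is p ^ (n + 1) * r ^ v. It belongs to `geoMeasure p`,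
which gives the start s mass r ^ s and then takes independent steps. Its total mass, the sum of the
r ^ s, is finite exactly for p > 1/2.

Extensions: a path that has entered the band i ≤ v ≤ i + n never leaves it. An extension is
therefore prescribed on all cylinder sets ending in the band. These cover the saturation, so the
extension is unique (`isExtension_unique`). It is r ^ (-i) times `geoMeasure p`, so its
normalization does not depend on i.

Ergodicity for p > 1/2: the restriction of `geoMeasure p` to an invariant set is again tail
invariant. Its density on cylinder sets is a bounded space-time harmonic function of the Bernoulli
walk, hence constant (`harmonic_eq_const`).

Conversely, under a tail invariant probability measure the conditional probability of staying is a
bounded martingale. Its limit is tail invariant, so ergodicity makes it a constant c, and then every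
term of the martingale is c (`exists_weight_succ_eq_mul`). The recursion forces geometric weights
with p = c. Non-atomicity excludes c = 1, and finite mass excludes c ≤ 1/2. -/

namespace PascalGBD

/-! ### Paths as a start vertex with increments -/

/-- The number of the vertex of level `n` visited by `x`. -/
def vert (x : pascalGBD.Path) (n : ℕ) : ℕ := (x.1 n).1

/-- Whether the `n`-th edge of `x` increases the number of the vertex. -/
def bit (x : pascalGBD.Path) (n : ℕ) : Bool := (x.1 n).2

lemma edge_eq (x : pascalGBD.Path) (n : ℕ) : x.1 n = (vert x n, bit x n) := rfl

lemma vert_succ (x : pascalGBD.Path) (n : ℕ) : vert x (n + 1) = vert x n + (bit x n).toNat := x.2 n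

lemma endVertex_eq (x : pascalGBD.Path) (n : ℕ) : endVertex x n = vert x (n + 1) := (x.2 n).symm

lemma vert_eq_sum (x : pascalGBD.Path) (n : ℕ) :
    vert x n = vert x 0 + ∑ k ∈ Finset.range n, (bit x k).toNat := by
  induction n with
  | zero => simp
  | succ n ih => rw [vert_succ, ih, Finset.sum_range_succ, add_assoc]

/-- The path with the given start and the given increments. -/
def pathOf (s : ℕ) (b : ℕ → Bool) : pascalGBD.Path := (pascalPath s b).1

@[simp] lemma bit_pathOf (s : ℕ) (b : ℕ → Bool) (n : ℕ) : bit (pathOf s b) n = b n := rfl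

@[simp] lemma vert_pathOf_zero (s : ℕ) (b : ℕ → Bool) : vert (pathOf s b) 0 = s := by
  simp [vert, pathOf, pascalPath]

lemma vert_pathOf (s : ℕ) (b : ℕ → Bool) (n : ℕ) :
    vert (pathOf s b) n = s + ∑ k ∈ Finset.range n, (b k).toNat := rfl

lemma mem_cylinderSet_iff {x y : pascalGBD.Path} {n : ℕ} :
    y ∈ cylinderSet x n ↔ vert y 0 = vert x 0 ∧ ∀ k ≤ n, bit y k = bit x k := by
  refine ⟨fun h => ⟨congrArg Prod.fst (h 0 n.zero_le), fun k hk => congrArg Prod.snd (h k hk)⟩,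
    fun h k hk => ?_⟩
  rw [edge_eq, edge_eq, h.2 k hk, vert_eq_sum y, vert_eq_sum x, h.1]
  congr 2
  exact Finset.sum_congr rfl fun j hj => by rw [h.2 j ((Finset.mem_range.1 hj).le.trans hk)]

lemma self_mem_cylinderSet (x : pascalGBD.Path) (n : ℕ) : x ∈ cylinderSet x n := fun _ _ => rfl

lemma cylinderSet_eq_of_mem {x y : pascalGBD.Path} {n : ℕ} (h : y ∈ cylinderSet x n) :
    cylinderSet y n = cylinderSet x n := by
  ext z
  exact forall₂_congr fun k hk => by rw [h k hk]

lemma cylinderSet_anti (x : pascalGBD.Path) {m n : ℕ} (h : m ≤ n) :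
    cylinderSet x n ⊆ cylinderSet x m := fun _ hy k hk => hy k (hk.trans h)

lemma endVertex_eq_of_mem {x y : pascalGBD.Path} {n : ℕ} (h : y ∈ cylinderSet x n) :
    endVertex y n = endVertex x n := by
  rw [endVertex, h n le_rfl, endVertex]

/-! ### Cylinder sets and the Borel structure -/

lemma measurableSet_cylinderSet (x : pascalGBD.Path) (n : ℕ) : MeasurableSet (cylinderSet x n) :=
  (TopologicalSpace.isOpen_generateFrom_of_mem ⟨x, n, rfl⟩ : IsOpen (cylinderSet x n)).measurableSet

/-- The initial segment of length `n + 1` of a path. -/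
def initial (n : ℕ) (x : pascalGBD.Path) : Fin (n + 1) → ℕ × Bool := fun k => x.1 k

lemma initial_eq_iff {n : ℕ} {x y : pascalGBD.Path} :
    initial n y = initial n x ↔ y ∈ cylinderSet x n :=
  ⟨fun h k hk => congrFun h ⟨k, Nat.lt_succ_of_le hk⟩,
    fun h => funext fun k => h k (Nat.le_of_lt_succ k.2)⟩

lemma preimage_initial (n : ℕ) (x : pascalGBD.Path) :
    initial n ⁻¹' {initial n x} = cylinderSet x n := by
  ext y
  exact initial_eq_iff

lemma measurable_initial (n : ℕ) : Measurable (initial n) := by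
  refine measurable_to_countable fun x => ?_
  rw [preimage_initial]
  exact measurableSet_cylinderSet x n

lemma measurable_edge (n : ℕ) : Measurable fun x : pascalGBD.Path => (x.1 n : ℕ × Bool) :=
  (measurable_pi_apply (Fin.last n)).comp (measurable_initial n)

lemma measurable_bit (n : ℕ) : Measurable fun x : pascalGBD.Path => bit x n :=
  measurable_snd.comp (measurable_edge n)

lemma measurable_pathOf (s : ℕ) : Measurable (pathOf s) :=
  measurable_subtype_coe.comp (measurable_pascalPath s)

/-- The family of all cylinder sets. -/
def cylinders : Set (Set pascalGBD.Path) := {S | ∃ x n, S = cylinderSet x n}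

lemma countable_cylinders : cylinders.Countable := by
  have h : cylinders ⊆ Set.range fun a : Σ n, (Fin (n + 1) → ℕ × Bool) =>
      initial a.1 ⁻¹' {a.2} := by
    rintro _ ⟨x, n, rfl⟩
    exact ⟨⟨n, initial n x⟩, preimage_initial n x⟩
  exact (Set.countable_range _).mono h

instance : SecondCountableTopology pascalGBD.Path := ⟨⟨cylinders, countable_cylinders, rfl⟩⟩

lemma generateFrom_cylinders :
    (inferInstance : MeasurableSpace pascalGBD.Path) = MeasurableSpace.generateFrom cylinders :=
  borel_eq_generateFrom_of_subbasis rfl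

lemma isPiSystem_cylinders : IsPiSystem cylinders := by
  rintro _ ⟨x, m, rfl⟩ _ ⟨y, n, rfl⟩ ⟨z, hzx, hzy⟩
  rw [← cylinderSet_eq_of_mem hzx, ← cylinderSet_eq_of_mem hzy]
  rcases le_total m n with h | h
  · exact ⟨z, n, Set.inter_eq_self_of_subset_right (cylinderSet_anti z h)⟩
  · exact ⟨z, m, Set.inter_eq_self_of_subset_left (cylinderSet_anti z h)⟩

lemma cylinderSet_zero (e : ℕ × Bool) :
    cylinderSet (pathOf e.1 fun _ => e.2) 0 = {x : pascalGBD.Path | x.1 0 = e} := by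
  ext x
  rw [mem_cylinderSet_iff]
  simp [edge_eq, Prod.ext_iff]

/-- Cylinder sets form a generating π-system, and the countably many cylinder sets of one edge cover
the space. -/
lemma ext_of_cylinderSet {μ ν : Measure pascalGBD.Path} [IsFiniteMeasure μ]
    (h : ∀ x n, μ (cylinderSet x n) = ν (cylinderSet x n)) : μ = ν := by
  obtain ⟨f, hf⟩ := exists_surjective_nat (ℕ × Bool)
  refine Measure.ext_of_generateFrom_of_iUnion cylinders
    (fun n => cylinderSet (pathOf (f n).1 fun _ => (f n).2) 0) generateFrom_cylinders
    isPiSystem_cylinders ?_ (fun n => ⟨_, _, rfl⟩) (fun _ => measure_ne_top _ _) ?_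
  · refine Set.eq_univ_of_forall fun x => Set.mem_iUnion.2 ?_
    obtain ⟨n, hn⟩ := hf (x.1 0)
    exact ⟨n, by rw [cylinderSet_zero]; exact hn.symm⟩
  · rintro _ ⟨x, n, rfl⟩
    exact h x n

/-! ### Exchanging initial segments -/

/-- The path with the increments of `y` up to the edge `n`, and those of `z` afterwards. -/
def splice (y : pascalGBD.Path) (n : ℕ) (z : pascalGBD.Path) : pascalGBD.Path :=
  pathOf (vert y 0) fun k => if k ≤ n then bit y k else bit z k

lemma splice_mem (y : pascalGBD.Path) (n : ℕ) (z : pascalGBD.Path) :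
    splice y n z ∈ cylinderSet y n :=
  mem_cylinderSet_iff.2 ⟨by simp [splice], fun _ hk => by simp [splice, hk]⟩

lemma bit_splice_of_lt (y : pascalGBD.Path) {n k : ℕ} (z : pascalGBD.Path) (h : n < k) :
    bit (splice y n z) k = bit z k := by
  simp [splice, h.not_ge]

lemma bit_splice_of_le (y : pascalGBD.Path) {n k : ℕ} (z : pascalGBD.Path) (h : k ≤ n) :
    bit (splice y n z) k = bit y k := by
  simp [splice, h]

lemma vert_splice (y : pascalGBD.Path) {n k : ℕ} (z : pascalGBD.Path)
    (hyz : endVertex y n = endVertex z n) (h : n < k) : vert (splice y n z) k = vert z k := by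
  induction k, h using Nat.le_induction with
  | base => rw [← endVertex_eq, endVertex_eq_of_mem (splice_mem y n z), hyz, endVertex_eq]
  | succ k hk ih => rw [vert_succ, ih, bit_splice_of_lt y z hk, ← vert_succ]

lemma tailEquiv_splice (y : pascalGBD.Path) (n : ℕ) (z : pascalGBD.Path)
    (hyz : endVertex y n = endVertex z n) : TailEquiv z (splice y n z) :=
  ⟨n + 1, fun k hk => by
    rw [edge_eq, edge_eq, bit_splice_of_lt y z hk, vert_splice y z hyz hk]⟩

lemma tailEquiv_symm {x y : pascalGBD.Path} (h : TailEquiv x y) : TailEquiv y x :=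
  h.imp fun _ hn k hk => (hn k hk).symm

lemma measurable_splice (y : pascalGBD.Path) (n : ℕ) : Measurable (splice y n) := by
  refine (measurable_pathOf _).comp (measurable_pi_lambda _ fun k => ?_)
  by_cases h : k ≤ n
  · simp [h]
  · simpa [h] using measurable_bit k

/-- Exchanging the initial segments of `x` and `y` is undone by the reverse exchange, so pulling
back a cylinder set inside that of `y` again gives a cylinder set. -/
lemma splice_mem_cylinderSet_iff {x y z : pascalGBD.Path} {n k : ℕ}
    (hz : z ∈ cylinderSet y n) (w : pascalGBD.Path) (hw : w ∈ cylinderSet x n) :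
    splice y n w ∈ cylinderSet z k ↔ w ∈ cylinderSet (splice x n z) k := by
  rw [mem_cylinderSet_iff, mem_cylinderSet_iff]
  rw [mem_cylinderSet_iff] at hz hw
  have h1 : vert (splice y n w) 0 = vert z 0 := by simp [splice, hz.1]
  have h2 : vert w 0 = vert (splice x n z) 0 := by simp [splice, hw.1]
  simp only [h1, h2, true_and]
  refine forall₂_congr fun j _ => ?_
  rcases le_or_gt j n with h | h
  · rw [bit_splice_of_le y w h, bit_splice_of_le x z h]
    exact iff_of_true (hz.2 j h).symm (hw.2 j h)
  · rw [bit_splice_of_lt y w h, bit_splice_of_lt x z h]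

/-- Changing the initial segment maps a tail invariant measure on one cylinder set to that on
another one. -/
lemma map_splice {μ : Measure pascalGBD.Path} [IsFiniteMeasure μ] (hμ : TailInvariant μ)
    {x y : pascalGBD.Path} {n : ℕ} (hxy : endVertex x n = endVertex y n) :
    (μ.restrict (cylinderSet x n)).map (splice y n) = μ.restrict (cylinderSet y n) := by
  refine ext_of_cylinderSet fun z k => ?_
  rw [Measure.map_apply (measurable_splice y n) (measurableSet_cylinderSet z k),
    Measure.restrict_apply (measurable_splice y n (measurableSet_cylinderSet z k)),
    Measure.restrict_apply (measurableSet_cylinderSet z k)]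
  -- Two cylinder sets are nested or disjoint. The only case with content is `z` inside the cylinder
  -- set of `y`: its pullback has the same length and end vertex, so tail invariance applies.
  rcases le_total k n with hkn | hkn
  · by_cases hy : y ∈ cylinderSet z k
    · have hsub : cylinderSet y n ⊆ cylinderSet z k :=
        (cylinderSet_anti y hkn).trans (cylinderSet_eq_of_mem hy).subset
      have hpre : cylinderSet x n ⊆ splice y n ⁻¹' cylinderSet z k :=
        fun w _ => hsub (splice_mem y n w)
      rw [Set.inter_eq_self_of_subset_right hsub, Set.inter_eq_self_of_subset_right hpre]
      exact hμ n x y hxy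
    · have hd : ∀ w ∈ cylinderSet y n, w ∉ cylinderSet z k := fun w hw hwz =>
        hy fun j hj => by rw [← hw j (hj.trans hkn), hwz j hj]
      have e1 : splice y n ⁻¹' cylinderSet z k ∩ cylinderSet x n = ∅ :=
        Set.eq_empty_of_forall_notMem fun w hw => hd _ (splice_mem y n w) hw.1
      have e2 : cylinderSet z k ∩ cylinderSet y n = ∅ :=
        Set.eq_empty_of_forall_notMem fun w hw => hd w hw.2 hw.1
      rw [e1, e2]
  · by_cases hz : z ∈ cylinderSet y n
    · have e1 : splice y n ⁻¹' cylinderSet z k ∩ cylinderSet x n =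
          cylinderSet (splice x n z) k := by
        ext w
        refine ⟨fun hw => (splice_mem_cylinderSet_iff hz w hw.2).1 hw.1, fun hw => ?_⟩
        have hwx : w ∈ cylinderSet x n :=
          (cylinderSet_eq_of_mem (splice_mem x n z)).subset (cylinderSet_anti _ hkn hw)
        exact ⟨(splice_mem_cylinderSet_iff hz w hwx).2 hw, hwx⟩
      have e2 : cylinderSet z k ∩ cylinderSet y n = cylinderSet z k :=
        Set.inter_eq_self_of_subset_left
          ((cylinderSet_anti z hkn).trans (cylinderSet_eq_of_mem hz).subset)
      rw [e1, e2]
      refine hμ k _ _ ?_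
      rw [endVertex_eq, endVertex_eq]
      exact vert_splice x z (by rw [hxy, endVertex_eq_of_mem hz]) (Nat.lt_succ_of_le hkn)
    · have hd : ∀ w ∈ cylinderSet y n, w ∉ cylinderSet z k := fun w hw hwz =>
        hz fun j hj => by rw [← hwz j (hj.trans hkn), hw j hj]
      have e1 : splice y n ⁻¹' cylinderSet z k ∩ cylinderSet x n = ∅ :=
        Set.eq_empty_of_forall_notMem fun w hw => hd _ (splice_mem y n w) hw.1
      have e2 : cylinderSet z k ∩ cylinderSet y n = ∅ :=
        Set.eq_empty_of_forall_notMem fun w hw => hd w hw.2 hw.1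
      rw [e1, e2]

/-- Splicing carries `μ` on one cylinder set to `μ` on the other and moves paths only within their
tail classes, so it respects `A`. -/
lemma tailInvariant_restrict {μ : Measure pascalGBD.Path} [IsFiniteMeasure μ]
    (hμ : TailInvariant μ) {A : Set pascalGBD.Path} (hA : MeasurableSet A)
    (hinv : ∀ x y, TailEquiv x y → x ∈ A → y ∈ A) : TailInvariant (μ.restrict A) := by
  intro n x y hxy
  have h := congrArg (fun ν => ν A) (map_splice hμ hxy)
  rw [Measure.map_apply (measurable_splice y n) hA,
    Measure.restrict_apply (measurable_splice y n hA), Measure.restrict_apply hA] at h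
  rw [Measure.restrict_apply (measurableSet_cylinderSet x n),
    Measure.restrict_apply (measurableSet_cylinderSet y n), Set.inter_comm _ A, Set.inter_comm _ A,
    ← h]
  congr 1
  ext w
  refine and_congr_left fun hw => ?_
  have ht := tailEquiv_splice y n w (by rw [← hxy, endVertex_eq_of_mem hw])
  exact ⟨hinv _ _ ht, hinv _ _ (tailEquiv_symm ht)⟩

/-! ### Weights and the Pascal recursion -/

/-- The measure of the cylinder sets of `n + 1` edges that end at the vertex `v`. -/
noncomputable def weight (μ : Measure pascalGBD.Path) (n v : ℕ) : ENNReal :=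
  μ (cylinderSet (pathOf v fun _ => false) n)

lemma endVertex_const_false (v n : ℕ) : endVertex (pathOf v fun _ => false) n = v := by
  rw [endVertex_eq, vert_pathOf]
  simp

lemma measure_cylinderSet {μ : Measure pascalGBD.Path} (hμ : TailInvariant μ) (x : pascalGBD.Path)
    (n : ℕ) : μ (cylinderSet x n) = weight μ n (endVertex x n) :=
  hμ n _ _ (endVertex_const_false _ n).symm

/-- The path that follows `x` up to the edge `n` and then always has increment `c`. -/
def extend (x : pascalGBD.Path) (n : ℕ) (c : Bool) : pascalGBD.Path :=
  splice x n (pathOf 0 fun _ => c)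

lemma mem_extend {x y : pascalGBD.Path} {n : ℕ} {c : Bool} :
    y ∈ cylinderSet (extend x n c) (n + 1) ↔ y ∈ cylinderSet x n ∧ bit y (n + 1) = c := by
  rw [mem_cylinderSet_iff, mem_cylinderSet_iff, and_assoc]
  refine and_congr (by simp [extend, splice]) ?_
  constructor
  · intro h
    refine ⟨fun k hk => ?_, ?_⟩
    · rw [h k (hk.trans n.le_succ), extend, bit_splice_of_le _ _ hk]
    · rw [h _ le_rfl, extend, bit_splice_of_lt _ _ n.lt_succ_self, bit_pathOf]
  · rintro ⟨h1, h2⟩ k hk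
    rcases Nat.le_succ_iff.1 hk with hk | rfl
    · rw [h1 k hk, extend, bit_splice_of_le _ _ hk]
    · rw [h2, extend, bit_splice_of_lt _ _ n.lt_succ_self, bit_pathOf]

lemma endVertex_extend (x : pascalGBD.Path) (n : ℕ) (c : Bool) :
    endVertex (extend x n c) (n + 1) = (endVertex x n + c.toNat : ℕ) := by
  have h := mem_extend.1 (self_mem_cylinderSet (extend x n c) (n + 1))
  rw [endVertex_eq, vert_succ, h.2, ← endVertex_eq, endVertex_eq_of_mem h.1]

lemma measure_cylinderSet_split (μ : Measure pascalGBD.Path) (x : pascalGBD.Path) (n : ℕ) :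
    μ (cylinderSet x n) = μ (cylinderSet (extend x n false) (n + 1)) +
      μ (cylinderSet (extend x n true) (n + 1)) := by
  rw [← measure_union _ (measurableSet_cylinderSet _ _)]
  · congr 1
    ext y
    rw [Set.mem_union, mem_extend, mem_extend]
    cases bit y (n + 1) <;> simp
  · refine Set.disjoint_left.2 fun y h1 h2 => ?_
    rw [mem_extend] at h1 h2
    simp [h1.2] at h2

lemma weight_eq_add {μ : Measure pascalGBD.Path} (hμ : TailInvariant μ) (n v : ℕ) :
    weight μ n v = weight μ (n + 1) v + weight μ (n + 1) (v + 1) := by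
  rw [weight, measure_cylinderSet_split, measure_cylinderSet hμ, measure_cylinderSet hμ,
    endVertex_extend, endVertex_extend, endVertex_const_false]
  rfl

lemma toReal_weight_eq_add {μ : Measure pascalGBD.Path} [IsFiniteMeasure μ]
    (hμ : TailInvariant μ) (n v : ℕ) :
    (weight μ n v).toReal =
      (weight μ (n + 1) v).toReal + (weight μ (n + 1) (v + 1)).toReal := by
  rw [weight_eq_add hμ]
  exact ENNReal.toReal_add (measure_ne_top μ _) (measure_ne_top μ _)

/-! ### Paths and saturation of the subdiagram -/

lemma vert_le (x : pascalGBD.Path) (n : ℕ) : vert x n ≤ vert x 0 + n := by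
  induction n with
  | zero => simp
  | succ n ih =>
    rw [vert_succ]
    have := Bool.toNat_le (bit x n)
    omega

lemma vert_mono (x : pascalGBD.Path) : Monotone (vert x) :=
  monotone_nat_of_le_succ fun n => by rw [vert_succ]; exact Nat.le_add_right _ _

lemma mem_paths_iff {i : ℕ} {x : pascalGBD.Path} : x ∈ (pascalSub i).paths ↔ vert x 0 = i := by
  refine ⟨fun h => ?_, fun h n => ?_⟩
  · have h0 : i ≤ vert x 0 ∧ vert x 0 ≤ i + 0 := h 0
    omega
  · exact ⟨h ▸ vert_mono x n.zero_le, h ▸ vert_le x n⟩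

lemma mem_saturation_of_vert {i : ℕ} {x : pascalGBD.Path} {n : ℕ} (h1 : i ≤ vert x n)
    (h2 : vert x n ≤ i + n) : x ∈ (pascalSub i).saturation := by
  -- Starting at `i`, climb as often as needed to reach the vertex of `x` at level `n`, stay until
  -- that level, then follow `x`.
  set b : ℕ → Bool := fun k => if k < n then decide (k < vert x n - i) else bit x k with hb
  have hvert : ∀ k ≥ n, vert (pathOf i b) k = vert x k := by
    intro k hk
    induction k, hk using Nat.le_induction with
    | base =>
      rw [vert_pathOf]
      have hsum : ∑ k ∈ Finset.range n, (b k).toNat =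
          ∑ k ∈ Finset.range n, if k < vert x n - i then 1 else 0 :=
        Finset.sum_congr rfl fun k hk => by
          rw [hb]
          simp only [Finset.mem_range.1 hk, if_true]
          by_cases h : k < vert x n - i <;> simp [h]
      rw [hsum, Finset.sum_ite, Finset.sum_const_zero, add_zero, Finset.sum_const, smul_eq_mul,
        mul_one]
      have : Finset.filter (fun k => k < vert x n - i) (Finset.range n) =
          Finset.range (vert x n - i) := by
        ext k
        simp only [Finset.mem_filter, Finset.mem_range]
        omega
      rw [this, Finset.card_range]
      omega
    | succ k hk ih => rw [vert_succ, vert_succ, ih, bit_pathOf]; simp [hb, hk.not_gt]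
  refine ⟨pathOf i b, mem_paths_iff.2 (vert_pathOf_zero i b), n, fun k hk => ?_⟩
  rw [edge_eq, edge_eq, hvert k hk, bit_pathOf]
  simp [hb, hk.not_gt]

/-- The number of a vertex never decreases and grows by at most one per level, so the band is never
left and the constraint on continuations is vacuous. -/
lemma continuations_eq {i n : ℕ} {x : pascalGBD.Path} (y : (pascalSub i).paths)
    (h : endVertex x n = endVertex y.1 n) :
    {z | z ∈ cylinderSet x n ∧ ∀ k > n, pascalGBD.source k (z.1 k) ∈ (pascalSub i).W k} =
      cylinderSet x n := by
  refine Set.inter_eq_left.2 fun z hz k hk => ?_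
  have hend : vert z (n + 1) = vert y.1 (n + 1) := by
    rw [← endVertex_eq, ← endVertex_eq, endVertex_eq_of_mem hz, h]
  have hy : i ≤ vert y.1 (n + 1) ∧ vert y.1 (n + 1) ≤ i + (n + 1) := y.2 (n + 1)
  rw [← hend] at hy
  have h2 : vert z k ≤ i + k := by
    induction k, hk using Nat.le_induction with
    | base => exact hy.2
    | succ k _ ih =>
      rw [vert_succ]
      have := Bool.toNat_le (bit z k)
      omega
  exact ⟨hy.1.trans (vert_mono z hk), h2⟩

instance (i : ℕ) (p : unitInterval) : IsProbabilityMeasure (pascalMeasure i p) :=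
  Measure.isProbabilityMeasure_map (measurable_pascalPath i).aemeasurable

/-- The cylinder sets of finite paths that end in a vertex of `pascalSub i`. -/
def goodCylinders (i : ℕ) : Set (Set pascalGBD.Path) :=
  {S | ∃ (n : ℕ) (x : pascalGBD.Path) (y : (pascalSub i).paths),
    endVertex x n = endVertex y.1 n ∧ S = cylinderSet x n}

lemma saturation_eq (i : ℕ) : (pascalSub i).saturation = ⋃ D : goodCylinders i, D.1 := by
  ext x
  rw [Set.mem_iUnion]
  constructor
  · rintro ⟨y, hy, n, hn⟩
    exact ⟨⟨_, n, x, ⟨y, hy⟩, congrArg (pascalGBD.range n) (hn n le_rfl), rfl⟩,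
      self_mem_cylinderSet x n⟩
  · rintro ⟨⟨_, n, z, y, h, rfl⟩, hx⟩
    have hy : i ≤ vert y.1 (n + 1) ∧ vert y.1 (n + 1) ≤ i + (n + 1) := y.2 (n + 1)
    have hx' : vert x (n + 1) = vert y.1 (n + 1) := by
      rw [← endVertex_eq, ← endVertex_eq, endVertex_eq_of_mem hx, h]
    rw [← hx'] at hy
    exact mem_saturation_of_vert hy.1 hy.2

lemma countable_goodCylinders (i : ℕ) : Countable (goodCylinders i) :=
  (countable_cylinders.mono (by rintro _ ⟨n, x, _, _, h⟩; exact ⟨x, n, h⟩ :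
    goodCylinders i ⊆ cylinders)).to_subtype

lemma measurableSet_saturation (i : ℕ) : MeasurableSet (pascalSub i).saturation := by
  have := countable_goodCylinders i
  rw [saturation_eq]
  refine MeasurableSet.iUnion ?_
  rintro ⟨_, n, x, _, _, rfl⟩
  exact measurableSet_cylinderSet x n

/-! ### Uniqueness of the extension -/

lemma isExtension_unique {i : ℕ} {p : unitInterval} {μ₁ μ₂ : Measure pascalGBD.Path}
    (h₁ : (pascalSub i).IsExtension (pascalMeasure i p) μ₁)
    (h₂ : (pascalSub i).IsExtension (pascalMeasure i p) μ₂) : μ₁ = μ₂ := by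
  have key : ∀ {μ : Measure pascalGBD.Path}, (pascalSub i).IsExtension (pascalMeasure i p) μ →
      ∀ (n : ℕ) (x : pascalGBD.Path) (y : (pascalSub i).paths), endVertex x n = endVertex y.1 n →
      μ (cylinderSet x n) = pascalMeasure i p {z | z.1 ∈ cylinderSet y.1 n} :=
    fun h n x y hxy => by rw [← h.1 n x y hxy, continuations_eq y hxy]
  have hsat : μ₁.restrict (pascalSub i).saturation = μ₂.restrict (pascalSub i).saturation := by
    have := countable_goodCylinders i
    rw [saturation_eq, Measure.restrict_iUnion_congr]
    rintro ⟨_, n, x, y, hxy, rfl⟩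
    have hfin : IsFiniteMeasure (μ₁.restrict (cylinderSet x n)) :=
      ⟨by rw [Measure.restrict_apply_univ, key h₁ n x y hxy]; exact measure_lt_top _ _⟩
    refine ext_of_cylinderSet fun z k => ?_
    change μ₁.restrict (cylinderSet x n) _ = μ₂.restrict (cylinderSet x n) _
    rw [Measure.restrict_apply (measurableSet_cylinderSet z k),
      Measure.restrict_apply (measurableSet_cylinderSet z k)]
    rcases (cylinderSet z k ∩ cylinderSet x n).eq_empty_or_nonempty with he | ⟨w, hwz, hwx⟩
    · simp [he]
    rw [← cylinderSet_eq_of_mem hwz, ← cylinderSet_eq_of_mem hwx]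
    rcases le_total k n with hkn | hkn
    · rw [Set.inter_eq_self_of_subset_right (cylinderSet_anti w hkn), cylinderSet_eq_of_mem hwx,
        key h₁ n x y hxy, key h₂ n x y hxy]
    · rw [Set.inter_eq_self_of_subset_left (cylinderSet_anti w hkn)]
      -- The segment of `y` followed by the increments of `w` is a path of the subdiagram ending
      -- where `w` does, so the longer cylinder set is prescribed too.
      have hy' : vert (splice y.1 n w) 0 = i := by
        rw [splice, vert_pathOf_zero]
        exact mem_paths_iff.1 y.2
      have hend : endVertex w k = endVertex (splice y.1 n w) k := by
        rw [endVertex_eq, endVertex_eq, vert_splice _ _ _ (Nat.lt_succ_of_le hkn)]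
        rw [← hxy, endVertex_eq_of_mem hwx]
      rw [key h₁ k w ⟨_, mem_paths_iff.2 hy'⟩ hend, key h₂ k w ⟨_, mem_paths_iff.2 hy'⟩ hend]
  rw [← Measure.restrict_eq_self_of_ae_mem (μ := μ₁) (s := (pascalSub i).saturation) h₁.2, hsat,
    Measure.restrict_eq_self_of_ae_mem (s := (pascalSub i).saturation) h₂.2]

/-! ### The geometric measure as extension -/

/-- The quotient of the weights of the edges `w → w + 1` and `w → w`. -/
noncomputable def ratio (p : unitInterval) : ENNReal := ENNReal.ofReal ((1 - p) / p)

lemma ofReal_mul_ratio {p : unitInterval} (hp : 0 < (p : ℝ)) :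
    ENNReal.ofReal p * ratio p = ENNReal.ofReal (1 - p) := by
  rw [ratio, ← ENNReal.ofReal_mul hp.le, mul_div_cancel₀ _ hp.ne']

/-- The tail invariant measure for which the start `s` has mass `ratio p ^ s` and the increments
are independent of the start and of each other. -/
noncomputable def geoMeasure (p : unitInterval) : Measure pascalGBD.Path :=
  Measure.sum fun s => ratio p ^ s • (pascalMeasure s p).map Subtype.val

/-- Since 1 - p = p * r, every edge contributes p and every climb one extra factor r; only the
length and the end vertex survive. -/
lemma ratio_pow_mul_prod {p : unitInterval} (hp : 0 < (p : ℝ)) (x : pascalGBD.Path) (n : ℕ) :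
    ratio p ^ vert x 0 *
      (∏ k ∈ Finset.range n, if bit x k then ENNReal.ofReal (1 - p) else ENNReal.ofReal p) =
      ENNReal.ofReal p ^ n * ratio p ^ vert x n := by
  induction n with
  | zero => simp
  | succ n ih =>
    rw [Finset.prod_range_succ, ← mul_assoc, ih, vert_succ]
    cases bit x n
    · simp only [Bool.false_eq_true, if_false, Bool.toNat_false, add_zero]
      ring
    · simp only [if_true, Bool.toNat_true]
      rw [← ofReal_mul_ratio hp]
      ring

lemma geoMeasure_cylinderSet {p : unitInterval} (hp : 0 < (p : ℝ)) (x : pascalGBD.Path) (n : ℕ) :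
    geoMeasure p (cylinderSet x n) =
      ENNReal.ofReal p ^ (n + 1) * ratio p ^ (endVertex x n : ℕ) := by
  rw [geoMeasure, Measure.sum_apply _ (measurableSet_cylinderSet x n), tsum_eq_single (vert x 0)]
  · rw [Measure.smul_apply, Measure.map_apply measurable_subtype_coe
      (measurableSet_cylinderSet x n),
      smul_eq_mul, endVertex_eq, ← ratio_pow_mul_prod hp]
    congr 1
    exact pascalMeasure_cylinder _ p ⟨x, mem_paths_iff.2 rfl⟩ n
  · intro s hs
    rw [Measure.smul_apply, Measure.map_apply measurable_subtype_coe
      (measurableSet_cylinderSet x n)]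
    have : (Subtype.val : (pascalSub s).paths → _) ⁻¹' cylinderSet x n = ∅ := by
      refine Set.eq_empty_of_forall_notMem fun z hz => hs ?_
      rw [← mem_paths_iff.1 z.2, (mem_cylinderSet_iff.1 hz).1]
    rw [this, measure_empty, smul_zero]

/-- A geometric series; truncated subtraction gives the right value `⊤` when `ratio p ≥ 1`. -/
lemma geoMeasure_univ (p : unitInterval) : geoMeasure p Set.univ = (1 - ratio p)⁻¹ := by
  rw [geoMeasure, Measure.sum_apply _ MeasurableSet.univ, ← ENNReal.tsum_geometric]
  refine tsum_congr fun s => ?_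
  rw [Measure.smul_apply, Measure.map_apply measurable_subtype_coe MeasurableSet.univ,
    Set.preimage_univ, measure_univ, smul_eq_mul, mul_one]

lemma ratio_pos {p : unitInterval} (h0 : 0 < (p : ℝ)) (h1 : (p : ℝ) < 1) : 0 < ratio p :=
  ENNReal.ofReal_pos.2 (div_pos (sub_pos.2 h1) h0)

lemma ratio_ne_top (p : unitInterval) : ratio p ≠ ⊤ := ENNReal.ofReal_ne_top

lemma ratio_lt_one {p : unitInterval} (hp : 1 / 2 < (p : ℝ)) : ratio p < 1 := by
  rw [ratio, ENNReal.ofReal_lt_one, div_lt_one (by linarith)]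
  linarith

lemma isFiniteMeasure_geoMeasure {p : unitInterval} (hp : 1 / 2 < (p : ℝ)) :
    IsFiniteMeasure (geoMeasure p) :=
  ⟨by
    rw [geoMeasure_univ, ENNReal.inv_lt_top]
    exact tsub_pos_of_lt (ratio_lt_one hp)⟩

lemma geoMeasure_univ_pos (p : unitInterval) : 0 < geoMeasure p Set.univ := by
  rw [geoMeasure_univ, ENNReal.inv_pos]
  exact (tsub_le_self.trans_lt ENNReal.one_lt_top).ne

lemma tailInvariant_geoMeasure {p : unitInterval} (hp : 0 < (p : ℝ)) :
    TailInvariant (geoMeasure p) := fun n x y h => by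
  rw [geoMeasure_cylinderSet hp, geoMeasure_cylinderSet hp, h]

lemma infinitePi_eventually_eq {p : unitInterval} (h0 : 0 < (p : ℝ)) (h1 : (p : ℝ) < 1) (c : Bool)
    (N : ℕ) :
    (Measure.infinitePi fun _ : ℕ => bernoulliMeasure false true p) {b | ∀ k ≥ N, b k = c} = 0 := by
  set q : ENNReal := bernoulliMeasure false true p {c} with hq
  have hq1 : q < 1 := by
    rw [hq, bernoulliMeasure_apply p (MeasurableSet.singleton _)]
    have e0 : (unitInterval.toNNReal p) < 1 := h1
    have e1 : (unitInterval.toNNReal (unitInterval.symm p)) < 1 := by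
      change 1 - (p : ℝ) < 1
      linarith
    cases c <;> simp [e0, e1]
  have hle : ∀ m : ℕ, (Measure.infinitePi fun _ : ℕ => bernoulliMeasure false true p)
      {b | ∀ k ≥ N, b k = c} ≤ q ^ m := by
    intro m
    calc _ ≤ (Measure.infinitePi fun _ : ℕ => bernoulliMeasure false true p)
          (Set.pi (Finset.Ico N (N + m)) fun _ => {c}) :=
          measure_mono fun b (hb : ∀ k ≥ N, b k = c) k hk => hb k (Finset.mem_Ico.1 hk).1
      _ = q ^ m := by
        rw [Measure.infinitePi_pi (fun _ => bernoulliMeasure false true p)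
          (fun _ _ => MeasurableSet.singleton _), Finset.prod_const, Nat.card_Ico,
          Nat.add_sub_cancel_left]
  exact le_antisymm (ge_of_tendsto' (ENNReal.tendsto_pow_atTop_nhds_zero_of_lt_one hq1) hle)
    zero_le

lemma mem_saturation_of_frequently {i s : ℕ} {b : ℕ → Bool} (ht : ∀ N, ∃ k ≥ N, b k = true)
    (hf : ∀ N, ∃ k ≥ N, b k = false) : pathOf s b ∈ (pascalSub i).saturation := by
  have h1 : ∀ m, ∃ n, m ≤ vert (pathOf s b) n := by
    intro m
    induction m with
    | zero => exact ⟨0, Nat.zero_le _⟩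
    | succ m ih =>
      obtain ⟨n, hn⟩ := ih
      obtain ⟨k, hk, hbk⟩ := ht n
      refine ⟨k + 1, ?_⟩
      have := vert_mono (pathOf s b) hk
      rw [vert_succ, bit_pathOf, hbk, Bool.toNat_true]
      omega
  -- The level minus the vertex number never decreases, written without subtraction.
  have hstep : ∀ k l, k ≤ l → vert (pathOf s b) l + k ≤ vert (pathOf s b) k + l := by
    intro k l hkl
    induction l, hkl using Nat.le_induction with
    | base => exact le_rfl
    | succ l _ ih =>
      rw [vert_succ]
      have := Bool.toNat_le (bit (pathOf s b) l)
      omega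
  have h2 : ∀ m, ∃ n, vert (pathOf s b) n + m ≤ s + n := by
    intro m
    induction m with
    | zero => exact ⟨0, by simp⟩
    | succ m ih =>
      obtain ⟨n, hn⟩ := ih
      obtain ⟨k, hk, hbk⟩ := hf n
      refine ⟨k + 1, ?_⟩
      have := hstep n k hk
      rw [vert_succ, bit_pathOf, hbk, Bool.toNat_false]
      omega
  obtain ⟨n₁, hn₁⟩ := h1 i
  -- With `m = s` the number of stays has made up for the start: the vertex number is at most the
  -- level.
  obtain ⟨n₂, hn₂⟩ := h2 s
  refine mem_saturation_of_vert (n := max n₁ n₂)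
    (hn₁.trans (vert_mono _ (le_max_left _ _))) ?_
  have := hstep n₂ _ (le_max_right n₁ n₂)
  omega

/-- Almost surely the path both climbs and stays infinitely often, so it enters the band. -/
lemma geoMeasure_compl_saturation {p : unitInterval} (h0 : 0 < (p : ℝ)) (h1 : (p : ℝ) < 1) (i : ℕ) :
    geoMeasure p (pascalSub i).saturationᶜ = 0 := by
  have hm := (measurableSet_saturation i).compl
  rw [geoMeasure, Measure.sum_apply _ hm, ENNReal.tsum_eq_zero]
  intro s
  rw [Measure.smul_apply, Measure.map_apply measurable_subtype_coe hm, pascalMeasure,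
    Measure.map_apply (measurable_pascalPath s) (measurable_subtype_coe hm)]
  refine smul_eq_zero_of_right _ (measure_mono_null (t := ⋃ (c : Bool) (N : ℕ),
    {b : ℕ → Bool | ∀ k ≥ N, b k = c}) (fun b hb => ?_) ?_)
  · by_contra hcon
    simp only [Set.mem_iUnion, Set.mem_ofPred_eq, not_exists, not_forall] at hcon
    refine hb (mem_saturation_of_frequently (s := s) (b := b) (fun N => ?_) fun N => ?_)
    · obtain ⟨k, hk, hbk⟩ := hcon false N
      exact ⟨k, hk, by simpa using hbk⟩
    · obtain ⟨k, hk, hbk⟩ := hcon true N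
      exact ⟨k, hk, by simpa using hbk⟩
  · exact measure_iUnion_null fun c => measure_iUnion_null fun N =>
      infinitePi_eventually_eq h0 h1 c N

/-- The factor rescales the paths starting at `i` from mass `ratio p ^ i` to mass one. -/
lemma isExtension_geoMeasure {p : unitInterval} (h0 : 0 < (p : ℝ)) (h1 : (p : ℝ) < 1) (i : ℕ) :
    (pascalSub i).IsExtension (pascalMeasure i p) ((ratio p ^ i)⁻¹ • geoMeasure p) := by
  refine ⟨fun n x y hxy => ?_, ?_⟩
  · rw [continuations_eq y hxy, Measure.smul_apply, geoMeasure_cylinderSet h0, hxy, endVertex_eq,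
      ← ratio_pow_mul_prod h0, mem_paths_iff.1 y.2, smul_eq_mul, ← mul_assoc,
      ENNReal.inv_mul_cancel (pow_ne_zero _ (ratio_pos h0 h1).ne')
        (ENNReal.pow_ne_top (ratio_ne_top p)), one_mul, pascalMeasure_cylinder]
    rfl
  · rw [Measure.smul_apply, geoMeasure_compl_saturation h0 h1, smul_zero]

lemma normalized_smul {μ : Measure pascalGBD.Path} {a : ENNReal} (ha : a ≠ 0) (ha' : a ≠ ⊤) :
    ((a • μ) Set.univ)⁻¹ • (a • μ) = (μ Set.univ)⁻¹ • μ := by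
  rw [smul_smul, Measure.smul_apply, smul_eq_mul, ENNReal.mul_inv (.inl ha) (.inl ha'),
    mul_right_comm, ENNReal.inv_mul_cancel ha ha', one_mul]

/-! ### Harmonic functions and ergodicity -/

/-- Bounded space-time harmonic functions of the Bernoulli walk are constant. -/
lemma harmonic_eq_const {p q : ℝ} (hp : 0 < p) (hq : 0 < q) (hpq : p + q = 1) {h : ℕ → ℕ → ℝ}
    (hb : ∀ n v, h n v ^ 2 ≤ 1)
    (hh : ∀ n v, h n v = p * h (n + 1) v + q * h (n + 1) (v + 1)) (n v : ℕ) : h n v = h 0 0 := by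
  obtain rfl : q = 1 - p := by linarith
  set d : ℕ → ℕ → ℝ := fun n v => h (n + 1) (v + 1) - h (n + 1) v with hd
  have hdh : ∀ n v, d n v = p * d (n + 1) v + (1 - p) * d (n + 1) (v + 1) := by
    intro n v
    simp only [hd]
    rw [hh (n + 1) (v + 1), hh (n + 1) v]
    ring
  -- Energy estimate: one step raises the mean of h² by exactly the variance p(1 - p)d², and d,
  -- being harmonic itself, has nondecreasing mean square. After k steps the accumulated variance is
  -- still bounded by 1.
  have key : ∀ (k n v : ℕ), h n v ^ 2 + k * (p * (1 - p)) * d n v ^ 2 ≤ 1 := by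
    intro k
    induction k with
    | zero => intro n v; simpa using hb n v
    | succ k ih =>
      intro n v
      have h1 : h n v ^ 2 + p * (1 - p) * d n v ^ 2 =
          p * h (n + 1) v ^ 2 + (1 - p) * h (n + 1) (v + 1) ^ 2 := by
        simp only [hd]
        rw [hh n v]
        ring
      have h2 : d n v ^ 2 ≤ p * d (n + 1) v ^ 2 + (1 - p) * d (n + 1) (v + 1) ^ 2 := by
        have : p * d (n + 1) v ^ 2 + (1 - p) * d (n + 1) (v + 1) ^ 2 - d n v ^ 2 =
            p * (1 - p) * (d (n + 1) v - d (n + 1) (v + 1)) ^ 2 := by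
          rw [hdh n v]
          ring
        have h3 : 0 ≤ p * (1 - p) * (d (n + 1) v - d (n + 1) (v + 1)) ^ 2 := by positivity
        linarith
      have h3 : (k : ℝ) * (p * (1 - p)) * d n v ^ 2 ≤
          k * (p * (1 - p)) * (p * d (n + 1) v ^ 2 + (1 - p) * d (n + 1) (v + 1) ^ 2) :=
        mul_le_mul_of_nonneg_left h2 (by positivity)
      have h4 := mul_le_mul_of_nonneg_left (ih (n + 1) v) hp.le
      have h5 := mul_le_mul_of_nonneg_left (ih (n + 1) (v + 1)) hq.le
      push_cast
      linarith
  have hd0 : ∀ n v, d n v = 0 := by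
    intro n v
    by_contra hne
    have hpos : 0 < p * (1 - p) * d n v ^ 2 := by positivity
    obtain ⟨k, hk⟩ := exists_nat_gt (1 / (p * (1 - p) * d n v ^ 2))
    rw [div_lt_iff₀ hpos] at hk
    have := key k n v
    have := sq_nonneg (h n v)
    linarith
  have hv : ∀ n v, h (n + 1) (v + 1) = h (n + 1) v := fun n v => sub_eq_zero.1 (hd0 n v)
  have hn : ∀ n v, h n v = h (n + 1) v := fun n v => by
    rw [hh n v, hv]
    ring
  have hn0 : ∀ n v, h n v = h 0 v := by
    intro n v
    induction n with
    | zero => rfl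
    | succ n ih => rw [← hn, ih]
  rw [hn0]
  induction v with
  | zero => rfl
  | succ v ih => rw [hn 0 (v + 1), hv, ← hn, ih]

lemma tailErgodic_geoMeasure {p : unitInterval} (hp : 1 / 2 < (p : ℝ)) (h1 : (p : ℝ) < 1) :
    TailErgodic (geoMeasure p) := by
  intro A hA hinv
  have h0 : 0 < (p : ℝ) := by linarith
  have := isFiniteMeasure_geoMeasure hp
  have hρ := tailInvariant_restrict (tailInvariant_geoMeasure h0) hA hinv
  set ρ := (geoMeasure p).restrict A with hρdef
  set r : ℝ := (1 - p) / p with hr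
  have hrpos : 0 < r := div_pos (sub_pos.2 h1) h0
  set W : ℕ → ℕ → ℝ := fun n v => (p : ℝ) ^ (n + 1) * r ^ v with hW
  have hWpos : ∀ n v, 0 < W n v := fun n v => by positivity
  have hgeo : ∀ n v, weight (geoMeasure p) n v = ENNReal.ofReal (W n v) := fun n v => by
    rw [weight, geoMeasure_cylinderSet h0, endVertex_const_false, hW,
      ENNReal.ofReal_mul (by positivity),
      ENNReal.ofReal_pow h0.le, ENNReal.ofReal_pow hrpos.le]
    rfl
  have hle : ∀ n v, weight ρ n v ≤ ENNReal.ofReal (W n v) := fun n v =>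
    (hgeo n v) ▸ Measure.restrict_apply_le A _
  set h : ℕ → ℕ → ℝ := fun n v => (weight ρ n v).toReal / W n v with hh
  have hh0 : ∀ n v, 0 ≤ h n v := fun n v => div_nonneg ENNReal.toReal_nonneg (hWpos n v).le
  have hh1 : ∀ n v, h n v ≤ 1 := fun n v => by
    rw [hh, div_le_one (hWpos n v)]
    exact ENNReal.toReal_le_of_le_ofReal (hWpos n v).le (hle n v)
  have hc := harmonic_eq_const h0 (sub_pos.2 h1) (by ring) (h := h)
    -- Dividing the Pascal recursion by `W n v` turns it into harmonicity, since `W` changes by the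
    -- factor p at a stay and p * r = 1 - p at a climb.
    (fun n v => pow_le_one₀ (hh0 n v) (hh1 n v)) (fun n v => by
      have hq : 1 - (p : ℝ) = p * r := (mul_div_cancel₀ _ h0.ne').symm
      simp only [hh, hW, hq, toReal_weight_eq_add hρ n v]
      field_simp
      ring)
  have heq : ρ = ENNReal.ofReal (h 0 0) • geoMeasure p := by
    refine ext_of_cylinderSet fun x n => ?_
    rw [Measure.smul_apply, smul_eq_mul, measure_cylinderSet hρ,
      measure_cylinderSet (tailInvariant_geoMeasure h0), hgeo, ← ENNReal.ofReal_mul (hh0 0 0),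
      ← hc n (endVertex x n : ℕ), hh, div_mul_cancel₀ _ (hWpos _ _).ne', ENNReal.ofReal_toReal]
    exact measure_ne_top ρ _
  -- As `ρ` is a constant multiple of the full measure, either the constant or the measure of `Aᶜ`
  -- vanishes.
  have hcompl : ρ Aᶜ = 0 := by
    rw [hρdef, Measure.restrict_apply hA.compl, Set.compl_inter_self, measure_empty]
  rw [heq, Measure.smul_apply, smul_eq_mul, mul_eq_zero] at hcompl
  refine hcompl.imp (fun h => ?_) id
  have hAA : ρ A = geoMeasure p A := by rw [hρdef, Measure.restrict_apply_self]
  rw [← hAA, heq, h, zero_smul, Measure.coe_zero, Pi.zero_apply]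

lemma geoMeasure_singleton {p : unitInterval} (hp : 1 / 2 < (p : ℝ)) (h1 : (p : ℝ) < 1)
    (x : pascalGBD.Path) : geoMeasure p {x} = 0 := by
  have hle : ∀ n : ℕ, geoMeasure p {x} ≤ ENNReal.ofReal p ^ n := fun n => calc
    geoMeasure p {x} ≤ geoMeasure p (cylinderSet x n) :=
      measure_mono (Set.singleton_subset_iff.2 (self_mem_cylinderSet x n))
    _ = ENNReal.ofReal p ^ (n + 1) * ratio p ^ (endVertex x n : ℕ) :=
      geoMeasure_cylinderSet (by linarith) x n
    _ ≤ ENNReal.ofReal p ^ n * 1 :=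
      mul_le_mul' (pow_le_pow_right_of_le_one' (ENNReal.ofReal_le_one.2 h1.le) n.le_succ)
        (pow_le_one' (ratio_lt_one hp).le _)
    _ = _ := mul_one _
  exact le_antisymm (ge_of_tendsto' (ENNReal.tendsto_pow_atTop_nhds_zero_of_lt_one
    (ENNReal.ofReal_lt_one.2 h1)) hle) zero_le

lemma isErgodicTailInvariantProb_geoMeasure {p : unitInterval} (hp : 1 / 2 < (p : ℝ))
    (h1 : (p : ℝ) < 1) :
    IsErgodicTailInvariantProb ((geoMeasure p Set.univ)⁻¹ • geoMeasure p) := by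
  have := isFiniteMeasure_geoMeasure hp
  refine ⟨⟨?_⟩, fun x => ?_, fun n x y h => ?_, fun A hA hinv => ?_⟩
  · rw [Measure.smul_apply, smul_eq_mul]
    exact ENNReal.inv_mul_cancel (geoMeasure_univ_pos p).ne' (measure_ne_top _ _)
  · rw [Measure.smul_apply, geoMeasure_singleton hp h1, smul_zero]
  · rw [Measure.smul_apply, Measure.smul_apply, tailInvariant_geoMeasure (by linarith) n x y h]
  · refine (tailErgodic_geoMeasure hp h1 A hA hinv).imp (fun h => ?_) fun h => ?_
    · rw [Measure.smul_apply, h, smul_zero]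
    · rw [Measure.smul_apply, h, smul_zero]

/-! ### The martingale of stay probabilities -/

/-- The filtration of the finite initial segments. -/
def initialFiltration :
    Filtration ℕ (inferInstance : MeasurableSpace pascalGBD.Path) where
  seq n := MeasurableSpace.comap (initial n) inferInstance
  mono' m n h := by
    have : initial m = (fun t k => t (Fin.castLE (Nat.succ_le_succ h) k)) ∘ initial n := rfl
    change MeasurableSpace.comap (initial m) _ ≤ _
    rw [this, ← MeasurableSpace.comap_comp]
    exact MeasurableSpace.comap_mono
      (measurable_pi_lambda _ fun k => measurable_pi_apply _).comap_le
  le' n := (measurable_initial n).comap_le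

variable {μ : Measure pascalGBD.Path}

/-- A set determined by finitely many edges is a countable disjoint union of cylinder sets. -/
lemma setIntegral_congr_of_cylinderSet {f g : pascalGBD.Path → ℝ} (hf : Integrable f μ)
    (hg : Integrable g μ) {n : ℕ}
    (h : ∀ x, ∫ y in cylinderSet x n, f y ∂μ = ∫ y in cylinderSet x n, g y ∂μ)
    {s : Set pascalGBD.Path} (hs : MeasurableSet[initialFiltration n] s) :
    ∫ y in s, f y ∂μ = ∫ y in s, g y ∂μ := by
  obtain ⟨T, -, rfl⟩ := hs
  have hU : initial n ⁻¹' T = ⋃ t : T, initial n ⁻¹' {t.1} := by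
    ext x
    simp
  have hm : ∀ t : T, MeasurableSet (initial n ⁻¹' {t.1}) := fun t =>
    measurable_initial n (MeasurableSet.singleton _)
  have hd : Pairwise (Function.onFun Disjoint fun t : T => initial n ⁻¹' {t.1}) := fun t u htu =>
    Set.disjoint_left.2 fun x (hx : _ = _) (hx' : _ = _) => htu (Subtype.ext (hx.symm.trans hx'))
  rw [hU, integral_iUnion hm hd hf.integrableOn, integral_iUnion hm hd hg.integrableOn]
  refine tsum_congr fun t => ?_
  rcases (initial n ⁻¹' {t.1}).eq_empty_or_nonempty with he | ⟨x, hx⟩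
  · simp [he]
  · rw [← (hx : initial n x = t.1), preimage_initial, h]

/-- The conditional probability, given the edges up to the edge `n`, that the next edge does not
increase the number of the vertex. -/
noncomputable def stayProb (μ : Measure pascalGBD.Path) (n : ℕ) (x : pascalGBD.Path) : ℝ :=
  (weight μ (n + 1) (endVertex x n)).toReal / (weight μ n (endVertex x n)).toReal

lemma stronglyMeasurable_stayProb (n : ℕ) :
    StronglyMeasurable[initialFiltration n] (stayProb μ n) := by
  have h : Measurable fun t : Fin (n + 1) → ℕ × Bool =>
      (weight μ (n + 1) ((t (Fin.last n)).1 + (t (Fin.last n)).2.toNat)).toReal /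
        (weight μ n ((t (Fin.last n)).1 + (t (Fin.last n)).2.toNat)).toReal :=
    measurable_of_countable _
  exact (h.comp (comap_measurable (initial n))).stronglyMeasurable

lemma toReal_weight_succ_le [IsFiniteMeasure μ] (hμ : TailInvariant μ) (n v : ℕ) :
    (weight μ (n + 1) v).toReal ≤ (weight μ n v).toReal := by
  rw [toReal_weight_eq_add hμ n v]
  exact le_add_of_nonneg_right ENNReal.toReal_nonneg

lemma norm_stayProb_le [IsFiniteMeasure μ] (hμ : TailInvariant μ) (n : ℕ) (x : pascalGBD.Path) :
    ‖stayProb μ n x‖ ≤ 1 := by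
  rw [stayProb, Real.norm_of_nonneg (div_nonneg ENNReal.toReal_nonneg ENNReal.toReal_nonneg)]
  exact div_le_one_of_le₀ (toReal_weight_succ_le hμ _ _) ENNReal.toReal_nonneg

lemma measurable_stayProb (n : ℕ) : Measurable (stayProb μ n) :=
  (stronglyMeasurable_stayProb n).measurable.mono (initialFiltration.le n) le_rfl

lemma integrable_stayProb [IsFiniteMeasure μ] (hμ : TailInvariant μ) (n : ℕ) :
    Integrable (stayProb μ n) μ :=
  Integrable.of_bound (measurable_stayProb n).aestronglyMeasurable 1
    (Filter.Eventually.of_forall (norm_stayProb_le hμ n))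

lemma setIntegral_stayProb_self [IsFiniteMeasure μ] (hμ : TailInvariant μ) (x : pascalGBD.Path)
    (n : ℕ) :
    ∫ y in cylinderSet x n, stayProb μ n y ∂μ = (weight μ (n + 1) (endVertex x n)).toReal := by
  have h : ∀ y ∈ cylinderSet x n, stayProb μ n y = stayProb μ n x := fun y hy => by
    rw [stayProb, endVertex_eq_of_mem hy, stayProb]
  rw [setIntegral_congr_fun (measurableSet_cylinderSet x n) h, setIntegral_const, smul_eq_mul,
    measureReal_def, measure_cylinderSet hμ, stayProb]
  rcases eq_or_ne (weight μ n (endVertex x n)).toReal 0 with h0 | h0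
  · rw [h0, zero_mul]
    exact le_antisymm ENNReal.toReal_nonneg (h0 ▸ toReal_weight_succ_le hμ _ _)
  · rw [mul_div_cancel₀ _ h0]

/-- The two one-edge extensions contribute the weights at `v` and `v + 1` on level index `n + 2`,
and the recursion adds them up. Behind this, climb-then-stay and stay-then-climb end at the same
vertex. -/
lemma setIntegral_stayProb_succ [IsFiniteMeasure μ] (hμ : TailInvariant μ) (x : pascalGBD.Path)
    (n : ℕ) :
    ∫ y in cylinderSet x n, stayProb μ (n + 1) y ∂μ =
      (weight μ (n + 1) (endVertex x n)).toReal := by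
  have hU : cylinderSet x n =
      cylinderSet (extend x n false) (n + 1) ∪ cylinderSet (extend x n true) (n + 1) := by
    ext y
    rw [Set.mem_union, mem_extend, mem_extend]
    cases bit y (n + 1) <;> simp
  have hd : Disjoint (cylinderSet (extend x n false) (n + 1))
      (cylinderSet (extend x n true) (n + 1)) := by
    refine Set.disjoint_left.2 fun y h1 h2 => ?_
    rw [mem_extend] at h1 h2
    simp [h1.2] at h2
  rw [hU, setIntegral_union hd (measurableSet_cylinderSet _ _)
    (integrable_stayProb hμ _).integrableOn (integrable_stayProb hμ _).integrableOn,
    setIntegral_stayProb_self hμ, setIntegral_stayProb_self hμ, endVertex_extend, endVertex_extend,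
    toReal_weight_eq_add hμ (n + 1)]
  rfl

lemma martingale_stayProb [IsFiniteMeasure μ] (hμ : TailInvariant μ) :
    Martingale (stayProb μ) initialFiltration μ :=
  martingale_of_setIntegral_eq_succ stronglyMeasurable_stayProb (integrable_stayProb hμ)
    fun n _ hs => setIntegral_congr_of_cylinderSet (integrable_stayProb hμ n)
      (integrable_stayProb hμ (n + 1)) (fun x => by
        rw [setIntegral_stayProb_self hμ, setIntegral_stayProb_succ hμ]) hs

/-- Under an ergodic measure, the conditional probability of not increasing the number of the vertex
is constant. -/
lemma exists_weight_succ_eq_mul [IsProbabilityMeasure μ] (hμ : TailInvariant μ)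
    (he : TailErgodic μ) :
    ∃ c : ℝ, ∀ n v, (weight μ (n + 1) v).toReal = c * (weight μ n v).toReal := by
  -- The limsup is defined at every path and ignores finitely many edges, so its level sets are
  -- exactly invariant.
  set g : pascalGBD.Path → ℝ := fun x => Filter.limsup (fun n => stayProb μ n x) Filter.atTop
    with hg
  have hgm : Measurable g := Measurable.limsup measurable_stayProb
  have hginv : ∀ x y, TailEquiv x y → g x = g y := by
    rintro x y ⟨n, hn⟩
    refine Filter.limsup_congr (Filter.eventually_atTop.2 ⟨n, fun k hk => ?_⟩)
    rw [stayProb, stayProb, endVertex, endVertex, hn k hk]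
  obtain ⟨c, hc⟩ : ∃ c, g =ᵐ[μ] Function.const _ c := by
    refine Filter.exists_eventuallyEq_const_of_forall_separating MeasurableSet fun U hU => ?_
    have h := he (g ⁻¹' U) (hgm hU) fun x y hxy (hx : g x ∈ U) =>
      show g y ∈ U from hginv x y hxy ▸ hx
    rcases h with h | h
    · exact .inr (measure_eq_zero_iff_ae_notMem.1 h)
    · exact .inl h
  have hconv : ∀ᵐ x ∂μ, Filter.Tendsto (fun n => stayProb μ n x) Filter.atTop (nhds c) := by
    have hbdd : ∀ n, eLpNorm (stayProb μ n) 1 μ ≤ (1 : NNReal) := fun n => by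
      refine (eLpNorm_le_of_ae_bound (Filter.Eventually.of_forall (norm_stayProb_le hμ n))).trans ?_
      simp
    filter_upwards [(martingale_stayProb hμ).submartingale.exists_ae_tendsto_of_bdd hbdd, hc]
      with x ⟨a, ha⟩ hx
    have : g x = a := ha.limsup_eq
    rw [← (this.symm.trans hx : a = c)]
    exact ha
  refine ⟨c, fun n v => ?_⟩
  set x : pascalGBD.Path := pathOf v fun _ => false with hx
  -- The integrals over a fixed cylinder set converge by boundedness, yet are constant in `k ≥ n` by
  -- the martingale property; comparing the two gives the claim.
  have hlim : Filter.Tendsto (fun k => ∫ y in cylinderSet x n, stayProb μ k y ∂μ) Filter.atTop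
      (nhds (∫ _ in cylinderSet x n, c ∂μ)) :=
    tendsto_integral_of_dominated_convergence (fun _ => 1)
      (fun k => (measurable_stayProb k).aestronglyMeasurable) (integrable_const _)
      (fun k => Filter.Eventually.of_forall (norm_stayProb_le hμ k)) (ae_restrict_of_ae hconv)
  have hconst : ∀ k ≥ n, ∫ y in cylinderSet x n, stayProb μ k y ∂μ =
      (weight μ (n + 1) v).toReal := by
    intro k hk
    have hs : MeasurableSet[initialFiltration n] (cylinderSet x n) :=
      ⟨{initial n x}, MeasurableSet.singleton _, preimage_initial n x⟩
    rw [← (martingale_stayProb hμ).setIntegral_eq hk hs, setIntegral_stayProb_self hμ, hx,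
      endVertex_const_false]
  have := tendsto_nhds_unique hlim (tendsto_const_nhds.congr' (Filter.eventually_atTop.2
    ⟨n, fun k hk => (hconst k hk).symm⟩))
  rw [← this, setIntegral_const, smul_eq_mul, mul_comm, measureReal_def]
  rfl

/-! ### Classification of the ergodic measures -/

lemma eq_of_mem_cylinderSet {x y : pascalGBD.Path} (h : ∀ n, y ∈ cylinderSet x n) : y = x :=
  Subtype.ext (funext fun n => h n n le_rfl)

lemma tendsto_measure_cylinderSet (μ : Measure pascalGBD.Path) [IsFiniteMeasure μ]
    (x : pascalGBD.Path) :
    Filter.Tendsto (fun n => μ (cylinderSet x n)) Filter.atTop (nhds (μ {x})) := by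
  have hI : {x} = ⋂ n, cylinderSet x n := by
    ext y
    rw [Set.mem_singleton_iff, Set.mem_iInter]
    exact ⟨fun h n => h ▸ self_mem_cylinderSet y n, eq_of_mem_cylinderSet⟩
  rw [hI]
  exact tendsto_measure_iInter_atTop (fun n => (measurableSet_cylinderSet x n).nullMeasurableSet)
    (fun _ _ h => cylinderSet_anti x h) ⟨0, measure_ne_top _ _⟩

lemma exists_eq_normalized_geoMeasure {μ : Measure pascalGBD.Path}
    (hμ : IsErgodicTailInvariantProb μ) :
    ∃ p : unitInterval, 1 / 2 < (p : ℝ) ∧ (p : ℝ) < 1 ∧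
      μ = (geoMeasure p Set.univ)⁻¹ • geoMeasure p := by
  have := hμ.isProbabilityMeasure
  have hinv := hμ.tailInvariant
  obtain ⟨c, hc⟩ := exists_weight_succ_eq_mul hinv hμ.tailErgodic
  set m : ℕ → ℕ → ℝ := fun n v => (weight μ n v).toReal with hm
  have hm0 : ∀ n v, 0 ≤ m n v := fun n v => ENNReal.toReal_nonneg
  have hadd : ∀ n v, m n v = m (n + 1) v + m (n + 1) (v + 1) := toReal_weight_eq_add hinv
  replace hc : ∀ n v, m (n + 1) v = c * m n v := hc
  have hpow : ∀ n v, m n v = c ^ n * m 0 v := by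
    intro n v
    induction n with
    | zero => simp
    | succ n ih => rw [hc, ih, pow_succ']; ring
  have hcyl : ∀ x n, μ (cylinderSet x n) = ENNReal.ofReal (m n (endVertex x n : ℕ)) := by
    intro x n
    rw [measure_cylinderSet hinv, hm]
    exact (ENNReal.ofReal_toReal (measure_ne_top μ _)).symm
  obtain ⟨w, hw⟩ : ∃ w, 0 < m 0 w := by
    by_contra! hcon
    have hzero : μ = 0 := ext_of_cylinderSet fun x n => by
      rw [hcyl, hpow, le_antisymm (hcon _) (hm0 _ _)]
      simp
    exact IsProbabilityMeasure.ne_zero μ hzero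
  have hrec : ∀ v, (1 - c) * m 0 v = c * m 0 (v + 1) := fun v => by
    have := hadd 0 v
    rw [hc, hc] at this
    linarith
  have hc0 : 0 ≤ c := by
    have := hm0 1 w
    rw [hc 0 w] at this
    exact nonneg_of_mul_nonneg_left this hw
  have hc1 : c ≤ 1 := by
    have h1 := hadd 0 w
    rw [hc 0 w] at h1
    have h2 := hm0 1 (w + 1)
    exact le_of_mul_le_mul_right (by linarith : c * m 0 w ≤ 1 * m 0 w) hw
  have hcpos : 0 < c := by
    refine hc0.lt_of_ne' fun h => hw.ne' ?_
    simpa [h] using hrec w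
  -- If c = 1, the recursion kills all weights except at vertex `0`, and the path staying there
  -- forever would be an atom.
  have hclt : c < 1 := by
    refine hc1.lt_of_ne fun h => ?_
    have hw0 : w = 0 := by
      rcases w with _ | w
      · rfl
      · refine absurd ?_ hw.ne'
        simpa [h, eq_comm] using hrec w
    have hlim := tendsto_measure_cylinderSet μ (pathOf 0 fun _ => false)
    rw [hμ.noAtoms] at hlim
    have hconst : ∀ n, μ (cylinderSet (pathOf 0 fun _ => false) n) = ENNReal.ofReal (m 0 0) :=
      fun n => by rw [hcyl, endVertex_const_false, hpow, h, one_pow, one_mul]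
    simp only [hconst] at hlim
    have h0 := tendsto_nhds_unique hlim tendsto_const_nhds
    rw [eq_comm, ENNReal.ofReal_eq_zero] at h0
    exact absurd h0 (not_le.2 (hw0 ▸ hw))
  have hgeom : ∀ v, m 0 v = ((1 - c) / c) ^ v * m 0 0 := by
    intro v
    induction v with
    | zero => simp
    | succ v ih =>
      have := hrec v
      rw [ih] at this
      rw [pow_succ]
      field_simp at this ⊢
      linarith
  set p : unitInterval := ⟨c, hc0, hc1⟩ with hp
  -- The division by `c` matches `c ^ n` in the weights of `μ` with `c ^ (n + 1)` in those of
  -- `geoMeasure p`.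
  have heq : μ = ENNReal.ofReal (m 0 0 / c) • geoMeasure p := by
    refine ext_of_cylinderSet fun x n => ?_
    have hr : 0 ≤ (1 - c) / c := div_nonneg (sub_nonneg.2 hc1) hc0
    rw [Measure.smul_apply, smul_eq_mul, geoMeasure_cylinderSet hcpos, ratio, hcyl, hpow, hgeom]
    change _ = _ * (ENNReal.ofReal c ^ (n + 1) * ENNReal.ofReal ((1 - c) / c) ^ _)
    rw [← ENNReal.ofReal_pow hc0, ← ENNReal.ofReal_pow hr, ← ENNReal.ofReal_mul (by positivity),
      ← ENNReal.ofReal_mul (div_nonneg (hm0 0 0) hc0)]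
    congr 1
    rw [pow_succ]
    generalize ((1 - c) / c) ^ _ = t
    field_simp
  have hone : ENNReal.ofReal (m 0 0 / c) * geoMeasure p Set.univ = 1 := by
    have h := measure_univ (μ := μ)
    rwa [heq, Measure.smul_apply, smul_eq_mul] at h
  refine ⟨p, ?_, hclt, ?_⟩
  -- For c ≤ 1/2 the total mass of `geoMeasure p` is infinite, so no multiple of it has mass one.
  · by_contra! hle
    have hle' : c ≤ 1 / 2 := hle
    have hratio : 1 ≤ ratio p := by
      rw [ratio, ENNReal.one_le_ofReal]
      change 1 ≤ (1 - c) / c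
      rw [le_div_iff₀ hcpos]
      linarith
    rw [geoMeasure_univ, tsub_eq_zero_of_le hratio, ENNReal.inv_zero] at hone
    rcases eq_or_ne (ENNReal.ofReal (m 0 0 / c)) 0 with h | h
    · simp [h] at hone
    · simp [ENNReal.mul_top h] at hone
  · rw [← ENNReal.eq_inv_of_mul_eq_one_left hone]
    exact heq

end PascalGBD

/-! ### The theorem -/

open PascalGBD

theorem theorem5p3 (i : ℕ) :
    (∀ p : unitInterval, 1 / 2 < (p : ℝ) → (p : ℝ) < 1 →
      (∃! μ' : Measure pascalGBD.Path, (pascalSub i).IsExtension (pascalMeasure i p) μ') ∧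
      (∀ μ' : Measure pascalGBD.Path, (pascalSub i).IsExtension (pascalMeasure i p) μ' →
        0 < μ' Set.univ ∧ μ' Set.univ < ⊤)) ∧
    {μ : Measure pascalGBD.Path | IsErgodicTailInvariantProb μ} =
      {μ : Measure pascalGBD.Path | ∃ p : unitInterval, 1 / 2 < (p : ℝ) ∧ (p : ℝ) < 1 ∧
        ∃ μ' : Measure pascalGBD.Path, (pascalSub i).IsExtension (pascalMeasure i p) μ' ∧
          μ = (μ' Set.univ)⁻¹ • μ'} := by
  have hsmul : ∀ p : unitInterval, 0 < (p : ℝ) → (p : ℝ) < 1 →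
      (ratio p ^ i)⁻¹ ≠ 0 ∧ (ratio p ^ i)⁻¹ ≠ ⊤ := fun p h0 h1 =>
    ⟨ENNReal.inv_ne_zero.2 (ENNReal.pow_ne_top (ratio_ne_top p)),
      ENNReal.inv_ne_top.2 (pow_ne_zero _ (ratio_pos h0 h1).ne')⟩
  refine ⟨fun p hp h1 => ?_, Set.ext fun μ => ⟨fun hμ => ?_, ?_⟩⟩
  · have h0 : 0 < (p : ℝ) := by linarith
    have hext := isExtension_geoMeasure h0 h1 i
    refine ⟨⟨_, hext, fun μ' h => isExtension_unique h hext⟩, fun μ' h => ?_⟩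
    have := isFiniteMeasure_geoMeasure hp
    obtain ⟨ha, ha'⟩ := hsmul p h0 h1
    rw [isExtension_unique h hext, Measure.smul_apply, smul_eq_mul]
    exact ⟨ENNReal.mul_pos ha (geoMeasure_univ_pos p).ne',
      ENNReal.mul_lt_top ha'.lt_top (measure_lt_top _ _)⟩
  · obtain ⟨p, hp, h1, rfl⟩ := exists_eq_normalized_geoMeasure hμ
    have h0 : 0 < (p : ℝ) := by linarith
    obtain ⟨ha, ha'⟩ := hsmul p h0 h1
    exact ⟨p, hp, h1, _, isExtension_geoMeasure h0 h1 i, (normalized_smul ha ha').symm⟩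
  · rintro ⟨p, hp, h1, μ', h, rfl⟩
    have h0 : 0 < (p : ℝ) := by linarith
    obtain ⟨ha, ha'⟩ := hsmul p h0 h1
    rw [isExtension_unique h (isExtension_geoMeasure h0 h1 i), normalized_smul ha ha']
    exact isErgodicTailInvariantProb_geoMeasure hp h1
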